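/- A mixed graph $D$ is obtained from a finite simple graph $G(D)$ (its underlying graph) by orienting a subset of the edges. Its Hermitian adjacency matrix $H(D)=[h_{uv}]$ has $h_{uv}=1$ if $\{u,v\}$ is an undirected edge, $h_{uv}=\mathsf{i}$ if $(u,v)$ is a directed edge, $h_{uv}=-\mathsf{i}$ if $(v,u)$ is a directed edge, and $h_{uv}=0$ otherwise. The Hermitian spectral radius $\rho(D)$ is the largest absolute value of an eigenvalue of $H(D)$. A mixed cycle $C$ of $D$ with successive vertices $v_1,v_2,\ldots,v_\ell,v_1$ ($\ell\geqslant 3$) is a cycle of $G(D)$ with the orientations it has in $D$; its value is $h(C)=h_{v_1v_2}h_{v_2v_3}\cdots h_{v_\ell v_1}$, and $C$ is called real if $h(C)=\pm1$, positive if $h(C)=1$, and even if $\ell$ is even. (These notions do not depend on the starting vertex or on the direction in which $C$ is traversed.) Theorem. Let $D$ be a connected mixed graph with at least two vertices (that is, $G(D)$ is connected and has at least one edge) such that every real mixed cycle of $D$ is positive and even. Then $\rho(D)>\rho(D-u)$ for every vertex $u$ of $D$, and $\rho(D)>\rho(D-e)$ for every (directed or undirected) edge $e$ of $D$. -/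

import Mathlib

/-- A mixed graph on the vertex set `V`: a simple graph (the underlying graph) together with an
orientation of a subset of its edges. `arc u v` says that `(u, v)` is a directed edge; an edge of
the underlying graph that carries no arc is an undirected edge. -/
structure MixedGraph (V : Type*) where
  underlying : SimpleGraph V
  arc : V → V → Prop
  adj_of_arc : ∀ ⦃u v : V⦄, arc u v → underlying.Adj u v
  arc_asymm : ∀ ⦃u v : V⦄, arc u v → ¬ arc v u

namespace MixedGraph

/-- `{u, v}` is an undirected edge of `D`. -/
def IsUndirected {V : Type*} (D : MixedGraph V) (u v : V) : Prop :=
  D.underlying.Adj u v ∧ ¬ D.arc u v ∧ ¬ D.arc v u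

open Classical in
/-- The Hermitian adjacency matrix of a mixed graph. -/
noncomputable def hermAdj {V : Type*} (D : MixedGraph V) : Matrix V V ℂ :=
  Matrix.of fun u v =>
    if D.IsUndirected u v then 1
    else if D.arc u v then Complex.I
    else if D.arc v u then -Complex.I
    else 0

theorem hermAdj_isHermitian {V : Type*} (D : MixedGraph V) : D.hermAdj.IsHermitian := by
  ext u v
  have hsymm : D.IsUndirected v u ↔ D.IsUndirected u v := by
    unfold IsUndirected
    rw [D.underlying.adj_comm]
    tauto
  have h1 := @arc_asymm V D u v
  simp only [Matrix.conjTranspose_apply, hermAdj, Matrix.of_apply, hsymm]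
  by_cases h : D.IsUndirected u v
  · simp [h, hsymm.2 h]
  · by_cases ha : D.arc u v <;> by_cases hb : D.arc v u <;> simp_all

/-- The Hermitian spectral radius: the largest absolute value of an eigenvalue of the Hermitian
adjacency matrix (and `0` for the mixed graph without vertices). -/
noncomputable def spectralRadius {V : Type*} [Fintype V] [DecidableEq V] (D : MixedGraph V) : ℝ :=
  ⨆ i : V, |D.hermAdj_isHermitian.eigenvalues i|

/-- The value of a mixed walk: the product of the entries of the Hermitian adjacency matrix along
the successive steps of the walk. -/
noncomputable def walkValue {V : Type*} (D : MixedGraph V) {u v : V}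
    (w : D.underlying.Walk u v) : ℂ :=
  (w.darts.map fun d => D.hermAdj d.fst d.snd).prod

/-- A closed mixed walk is real if its value is `1` or `-1`. -/
def IsReal {V : Type*} (D : MixedGraph V) {v : V} (w : D.underlying.Walk v v) : Prop :=
  D.walkValue w = 1 ∨ D.walkValue w = -1

/-- A closed mixed walk is positive if its value is `1`. -/
def IsPositive {V : Type*} (D : MixedGraph V) {v : V} (w : D.underlying.Walk v v) : Prop :=
  D.walkValue w = 1

/-- `D - u`: delete the vertex `u` and all edges at `u`. -/
def deleteVertex {V : Type*} (D : MixedGraph V) (u : V) : MixedGraph {w : V // w ≠ u} where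
  underlying := D.underlying.comap Subtype.val
  arc a b := D.arc a b
  adj_of_arc _ _ h := D.adj_of_arc h
  arc_asymm _ _ h := D.arc_asymm h

/-- `D - e`: delete the edge `e` (directed or not) and keep all vertices. -/
def deleteEdge {V : Type*} (D : MixedGraph V) (e : Sym2 V) : MixedGraph V where
  underlying := D.underlying.deleteEdges {e}
  arc a b := D.arc a b ∧ s(a, b) ≠ e
  adj_of_arc _ _ h := by
    rw [SimpleGraph.deleteEdges_adj]
    exact ⟨D.adj_of_arc h.1, h.2⟩
  arc_asymm _ _ h h' := D.arc_asymm h.1 h'.1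

end MixedGraph

/-! Fix a vertex u, let z be column u of H = H(D), and let A be H with row and column u set to zero.
Splitting walks at their returns places each entry (A^k)_ab in the cone of values of paths from a to
b avoiding u. Closed up through u, such a path becomes a cycle or a retraced edge; its value is not
-1, so has real part ≥ 0. Hence all Re(h_ua (A^k)_ab h_bu) are nonnegative
(`RealCyclesPositive.re_closed_pow_nonneg`), which replaces the entrywise positivity of
Perron-Frobenius: erasing entry v of z lowers z*A^k z by at least (A^k)_vv.

Vertices: by ‖Hx‖ ≤ ρ‖x‖, an eigenvector of A with |l| ≥ ρ is an extremal eigenvector of H vanishing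
at u. Comparing growth rates, it vanishes at the neighbours of u, and by connectedness everywhere.

Edges: D - uv has the same A, while z becomes z', with entry v erased. An eigenvalue l of D - uv
with |l| ≥ ρ satisfies l = Σ z'*A^k z'/l^(k+1), so |l| ≤ Σ z'*A^k z'/|l|^(k+1) < Σ z*A^k z/|l|^(k+1)
≤ |l|, the last step by `RealCyclesPositive.sum_div_le`; a contradiction. -/

/-- Walks are split at their last visit to `v`. Column `v` of `T₀` is free: with row `v` zero, a
walk that enters `v` cannot leave it. -/
theorem Matrix.pow_apply_eq_sum_returns {V R : Type*} [Fintype V] [DecidableEq V] [CommRing R]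
    {T T₀ : Matrix V V R} {v : V} (hrow : ∀ w, T₀ v w = 0)
    (hrest : ∀ a w, a ≠ v → w ≠ v → T a w = T₀ a w) (k : ℕ) {w : V} (hw : w ≠ v) :
    (T ^ k) v w = ∑ j ∈ Finset.range k, (T ^ j) v v * (T * T₀ ^ (k - 1 - j)) v w := by
  induction k generalizing w with
  | zero => simp [Matrix.one_apply_ne hw.symm]
  | succ k ih =>
    have hlast : ∀ j ∈ Finset.range k, (T ^ j) v v * (T * T₀ ^ (k + 1 - 1 - j)) v w =
        ∑ a ∈ Finset.univ.erase v, (T ^ j) v v * (T * T₀ ^ (k - 1 - j)) v a * T a w := by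
      intro j hj
      have hk : k + 1 - 1 - j = (k - 1 - j) + 1 := by
        have := Finset.mem_range.1 hj
        omega
      rw [hk, pow_succ, ← mul_assoc, Matrix.mul_apply, ← Finset.add_sum_erase _ _ (Finset.mem_univ v),
        hrow, mul_zero, zero_add, Finset.mul_sum]
      refine Finset.sum_congr rfl fun a ha => ?_
      rw [hrest a w (Finset.ne_of_mem_erase ha) hw, mul_assoc]
    rw [Finset.sum_range_succ, Finset.sum_congr rfl hlast, Finset.sum_comm, pow_succ,
      Matrix.mul_apply, ← Finset.add_sum_erase _ _ (Finset.mem_univ v), add_comm]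
    congr 1
    · refine Finset.sum_congr rfl fun a ha => ?_
      rw [ih (Finset.ne_of_mem_erase ha), Finset.sum_mul]
    · simp

/-! ### Values of walks and cycles -/

namespace MixedGraph

variable {V : Type*} (D : MixedGraph V)

theorem hermAdj_apply_eq_zero {u v : V} (h : ¬ D.underlying.Adj u v) : D.hermAdj u v = 0 := by
  have h₁ : ¬ D.IsUndirected u v := fun h' => h h'.1
  have h₂ : ¬ D.arc u v := fun h' => h (D.adj_of_arc h')
  have h₃ : ¬ D.arc v u := fun h' => h (D.adj_of_arc h').symm
  simp [hermAdj, h₁, h₂, h₃]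

theorem hermAdj_apply_mem {u v : V} (h : D.underlying.Adj u v) :
    D.hermAdj u v = 1 ∨ D.hermAdj u v = Complex.I ∨ D.hermAdj u v = -Complex.I := by
  by_cases h₁ : D.arc u v
  · have h₀ : ¬ D.IsUndirected u v := fun h' => h'.2.1 h₁
    simp [hermAdj, h₀, h₁]
  by_cases h₂ : D.arc v u
  · have h₀ : ¬ D.IsUndirected u v := fun h' => h'.2.2 h₂
    simp [hermAdj, h₀, h₁, h₂]
  · have h₀ : D.IsUndirected u v := ⟨h, h₁, h₂⟩
    simp [hermAdj, h₀]

theorem star_hermAdj_apply (u v : V) : star (D.hermAdj u v) = D.hermAdj v u :=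
  D.hermAdj_isHermitian.apply v u

theorem hermAdj_mul_hermAdj_symm {u v : V} (h : D.underlying.Adj u v) :
    D.hermAdj u v * D.hermAdj v u = 1 := by
  rw [← D.star_hermAdj_apply u v]
  rcases D.hermAdj_apply_mem h with h | h | h <;> simp [h]

@[simp]
theorem walkValue_nil {u : V} : D.walkValue (SimpleGraph.Walk.nil : D.underlying.Walk u u) = 1 := by
  simp [walkValue]

@[simp]
theorem walkValue_cons {u v w : V} (h : D.underlying.Adj u v) (p : D.underlying.Walk v w) :
    D.walkValue (p.cons h) = D.hermAdj u v * D.walkValue p := by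
  simp [walkValue]

@[simp]
theorem walkValue_concat {u v w : V} (p : D.underlying.Walk u v) (h : D.underlying.Adj v w) :
    D.walkValue (p.concat h) = D.walkValue p * D.hermAdj v w := by
  simp [walkValue]

theorem walkValue_mem {u v : V} (p : D.underlying.Walk u v) :
    D.walkValue p = 1 ∨ D.walkValue p = -1 ∨ D.walkValue p = Complex.I ∨
      D.walkValue p = -Complex.I := by
  induction p with
  | nil => simp
  | cons h p ih =>
    rw [walkValue_cons]
    rcases D.hermAdj_apply_mem h with h | h | h <;> rcases ih with ih | ih | ih | ih <;>
      simp [h, ih]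

/-- No mixed cycle has value `-1`. -/
def RealCyclesPositive : Prop :=
  ∀ (v : V) (C : D.underlying.Walk v v), C.IsCycle → D.IsReal C → D.IsPositive C

variable {D}

/-- Values are fourth roots of unity, and only -1 has negative real part. -/
theorem RealCyclesPositive.re_walkValue_nonneg (hD : D.RealCyclesPositive) {v : V}
    {C : D.underlying.Walk v v} (hC : C.IsCycle) : 0 ≤ (D.walkValue C).re := by
  have := hD v C hC
  unfold IsReal IsPositive at this
  rcases D.walkValue_mem C with h | h | h | h
  · simp [h]
  · rw [this (Or.inr h)]
    simp
  · simp [h]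
  · simp [h]

/-- The closed walk is a cycle unless `a = b`, when it retraces one edge and has value 1. -/
theorem RealCyclesPositive.re_closed_nonneg (hD : D.RealCyclesPositive) {v a b : V}
    (hb : D.underlying.Adj v b) (ha : D.underlying.Adj a v) {p : D.underlying.Walk b a}
    (hp : p.IsPath) (hv : v ∉ p.support) :
    0 ≤ (D.hermAdj v b * D.walkValue p * D.hermAdj a v).re := by
  by_cases hab : b = a
  · subst hab
    obtain rfl := (SimpleGraph.Walk.isPath_iff_nil.1 hp).eq_nil
    simp [D.hermAdj_mul_hermAdj_symm hb]
  · have hC : ((p.concat ha).cons hb).IsCycle := by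
      rw [SimpleGraph.Walk.cons_isCycle_iff]
      refine ⟨hp.concat hv ha, ?_⟩
      rw [SimpleGraph.Walk.edges_concat, List.concat_eq_append, List.mem_append]
      rintro (h | h)
      · exact hv (p.fst_mem_support_of_mem_edges h)
      · have := List.mem_singleton.1 h
        rw [Sym2.eq_swap, Sym2.congr_left] at this
        exact hab this
    have := hD.re_walkValue_nonneg hC
    rwa [walkValue_cons, walkValue_concat, ← mul_assoc] at this

/-! ### Powers of the adjacency matrix and the cone of path values -/

open Classical in
/-- The Hermitian adjacency matrix with the rows and columns outside `S` replaced by zero. -/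
noncomputable def hermAdjOn (D : MixedGraph V) (S : Set V) : Matrix V V ℂ :=
  Matrix.of fun a b => if a ∈ S ∧ b ∈ S then D.hermAdj a b else 0

theorem hermAdjOn_apply_of_mem {S : Set V} {a b : V} (ha : a ∈ S) (hb : b ∈ S) :
    D.hermAdjOn S a b = D.hermAdj a b := by
  simp [hermAdjOn, ha, hb]

theorem hermAdjOn_apply_of_notMem_left {S : Set V} {a : V} (ha : a ∉ S) (b : V) :
    D.hermAdjOn S a b = 0 := by
  simp [hermAdjOn, ha]

theorem hermAdjOn_apply_of_notMem_right {S : Set V} (a : V) {b : V} (hb : b ∉ S) :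
    D.hermAdjOn S a b = 0 := by
  simp [hermAdjOn, hb]

variable (D) in
theorem hermAdjOn_isHermitian (S : Set V) : (D.hermAdjOn S).IsHermitian := by
  ext a b
  by_cases ha : a ∈ S <;> by_cases hb : b ∈ S <;>
    simp [hermAdjOn, ha, hb, D.star_hermAdj_apply]

variable [Fintype V] [DecidableEq V]

theorem hermAdjOn_pow_diag_im (S : Set V) (k : ℕ) (v : V) : ((D.hermAdjOn S ^ k) v v).im = 0 :=
  Complex.conj_eq_iff_im.1 (((D.hermAdjOn_isHermitian S).pow k).apply v v)

/-- An entry of a power of the Hermitian adjacency matrix lies in the convex cone spanned by the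
values of the paths joining its indices. -/
theorem RealCyclesPositive.re_mul_pow_nonneg (hD : D.RealCyclesPositive) (k : ℕ) (S : Set V)
    {a b : V} (ha : a ∈ S) (hb : b ∈ S) (c : ℂ)
    (hc : ∀ p : D.underlying.Walk a b, p.IsPath → (∀ x ∈ p.support, x ∈ S) →
      0 ≤ (c * D.walkValue p).re) :
    0 ≤ (c * (D.hermAdjOn S ^ k) a b).re := by
  induction k using Nat.strong_induction_on generalizing S a b c with
  | _ k ih =>
  -- The only path from `a` to `a` is trivial, so the induction hypothesis applies with constant 1.
  have hdiag : ∀ j < k, ∃ r : ℝ, 0 ≤ r ∧ (D.hermAdjOn S ^ j) a a = r := by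
    intro j hj
    refine ⟨((D.hermAdjOn S ^ j) a a).re, ?_, ?_⟩
    · rw [← one_mul ((D.hermAdjOn S ^ j) a a)]
      refine ih j hj S ha ha 1 fun p hp _ => ?_
      rw [(SimpleGraph.Walk.isPath_iff_nil.1 hp).eq_nil]
      simp
    · exact Complex.ext rfl (by simp [hermAdjOn_pow_diag_im])
  -- After the last visit to `a` the walk stays in `S \ {a}`, and the returns contribute nonnegative
  -- factors. The exponent, end vertex and constant vary because the diagonal case needs others.
  have hstep : ∀ m ≤ k, ∀ b ∈ S, b ≠ a → ∀ c : ℂ,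
      (∀ d, D.underlying.Adj a d → ∀ p : D.underlying.Walk d b, p.IsPath →
        (∀ x ∈ p.support, x ∈ S \ {a}) → 0 ≤ (c * D.hermAdj a d * D.walkValue p).re) →
      0 ≤ (c * (D.hermAdjOn S ^ m) a b).re := by
    intro m hm b hb hba c hc
    rw [Matrix.pow_apply_eq_sum_returns (T₀ := D.hermAdjOn (S \ {a}))
      (fun w => hermAdjOn_apply_of_notMem_left (by simp) w) ?_ m hba, Finset.mul_sum, Complex.re_sum]
    · refine Finset.sum_nonneg fun j hj => ?_
      obtain ⟨r, hr, hjr⟩ := hdiag j ((Finset.mem_range.1 hj).trans_le hm)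
      rw [hjr, mul_left_comm, Complex.re_ofReal_mul, Matrix.mul_apply, Finset.mul_sum, Complex.re_sum]
      refine mul_nonneg hr (Finset.sum_nonneg fun d _ => ?_)
      by_cases hd : d ∈ S ∧ D.underlying.Adj a d
      · rw [hermAdjOn_apply_of_mem ha hd.1, ← mul_assoc]
        have hlt : m - 1 - j < k := by
          have := Finset.mem_range.1 hj
          omega
        exact ih _ hlt (S \ {a}) ⟨hd.1, hd.2.ne'⟩ ⟨hb, hba⟩ _ (hc d hd.2)
      · have : D.hermAdjOn S a d = 0 := by
          by_cases hdS : d ∈ S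
          · rw [hermAdjOn_apply_of_mem ha hdS]
            exact D.hermAdj_apply_eq_zero fun h => hd ⟨hdS, h⟩
          · exact hermAdjOn_apply_of_notMem_right a hdS
        simp [this]
    · intro x w hx hw
      by_cases hxS : x ∈ S
      · by_cases hwS : w ∈ S
        · rw [hermAdjOn_apply_of_mem hxS hwS,
            hermAdjOn_apply_of_mem (S := S \ {a}) ⟨hxS, hx⟩ ⟨hwS, hw⟩]
        · rw [hermAdjOn_apply_of_notMem_right x hwS,
            hermAdjOn_apply_of_notMem_right (S := S \ {a}) x fun h => hwS h.1]
      · rw [hermAdjOn_apply_of_notMem_left hxS,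
          hermAdjOn_apply_of_notMem_left (S := S \ {a}) fun h => hxS h.1]
  by_cases hba : b = a
  · subst hba
    have hc₀ : 0 ≤ c.re := by
      simpa using hc SimpleGraph.Walk.nil SimpleGraph.Walk.IsPath.nil (by simpa using ha)
    rw [Complex.mul_re, hermAdjOn_pow_diag_im, mul_zero, sub_zero]
    refine mul_nonneg hc₀ ?_
    rcases k with _ | k
    · simp
    -- Split off the last step `d → b`; it serves as the constant for the walks from `b` to `d`,
    -- whose paths it closes.
    · rw [pow_succ, Matrix.mul_apply, Complex.re_sum]
      refine Finset.sum_nonneg fun d _ => ?_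
      by_cases hd : d ∈ S ∧ D.underlying.Adj d b
      · rw [mul_comm, hermAdjOn_apply_of_mem hd.1 hb]
        refine hstep k (Nat.le_succ k) d hd.1 hd.2.ne _ fun x hx p hp hpS => ?_
        have := hD.re_closed_nonneg hx hd.2 hp fun h => (hpS _ h).2 rfl
        rwa [mul_assoc, mul_comm]
      · have : D.hermAdjOn S d b = 0 := by
          by_cases hdS : d ∈ S
          · rw [hermAdjOn_apply_of_mem hdS hb]
            exact D.hermAdj_apply_eq_zero fun h => hd ⟨hdS, h⟩
          · exact hermAdjOn_apply_of_notMem_left hdS b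
        simp [this]
  · refine hstep k le_rfl b hb hba c fun d hd p hp hpS => ?_
    rw [mul_assoc, ← walkValue_cons D hd p]
    refine hc _ (hp.cons fun h => (hpS _ h).2 rfl) ?_
    intro x hx
    rw [SimpleGraph.Walk.support_cons, List.mem_cons] at hx
    rcases hx with rfl | hx
    · exact ha
    · exact (hpS x hx).1

theorem RealCyclesPositive.re_pow_diag_nonneg (hD : D.RealCyclesPositive) (k : ℕ) {S : Set V}
    {v : V} (hv : v ∈ S) : 0 ≤ ((D.hermAdjOn S ^ k) v v).re := by
  rw [← one_mul ((D.hermAdjOn S ^ k) v v)]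
  refine hD.re_mul_pow_nonneg k S hv hv 1 fun p hp _ => ?_
  rw [(SimpleGraph.Walk.isPath_iff_nil.1 hp).eq_nil]
  simp

theorem RealCyclesPositive.re_closed_pow_nonneg (hD : D.RealCyclesPositive) (k : ℕ) (u a b : V) :
    0 ≤ (D.hermAdj u a * (D.hermAdjOn {u}ᶜ ^ k) a b * D.hermAdj b u).re := by
  by_cases ha : D.underlying.Adj u a
  · by_cases hb : D.underlying.Adj b u
    · rw [mul_right_comm]
      refine hD.re_mul_pow_nonneg k _ ha.ne' hb.ne _ fun p hp hpS => ?_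
      rw [mul_right_comm]
      exact hD.re_closed_nonneg ha hb hp fun h => hpS _ h rfl
    · simp [D.hermAdj_apply_eq_zero hb]
  · simp [D.hermAdj_apply_eq_zero ha]

end MixedGraph

/-! ### Eigenvector coordinates of a Hermitian matrix -/

namespace Matrix.IsHermitian

variable {n : Type*} [Fintype n] [DecidableEq n] {A : Matrix n n ℂ} (hA : A.IsHermitian)

/-- The coordinates of a vector in the eigenvector basis of a Hermitian matrix. -/
noncomputable def eigenCoord (x : n → ℂ) : n → ℂ :=
  star (hA.eigenvectorUnitary : Matrix n n ℂ) *ᵥ x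

theorem eigenvectorUnitary_mulVec_eigenCoord (x : n → ℂ) :
    (hA.eigenvectorUnitary : Matrix n n ℂ) *ᵥ hA.eigenCoord x = x := by
  simp [eigenCoord, Matrix.mulVec_mulVec]

theorem eigenCoord_eigenvectorUnitary_mulVec (c : n → ℂ) :
    hA.eigenCoord ((hA.eigenvectorUnitary : Matrix n n ℂ) *ᵥ c) = c := by
  simp [eigenCoord, Matrix.mulVec_mulVec]

theorem eigenCoord_injective : Function.Injective hA.eigenCoord :=
  Function.LeftInverse.injective hA.eigenvectorUnitary_mulVec_eigenCoord

theorem eigenCoord_add (x y : n → ℂ) :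
    hA.eigenCoord (x + y) = hA.eigenCoord x + hA.eigenCoord y :=
  Matrix.mulVec_add _ _ _

theorem eigenCoord_sub (x y : n → ℂ) :
    hA.eigenCoord (x - y) = hA.eigenCoord x - hA.eigenCoord y :=
  Matrix.mulVec_sub _ _ _

theorem eigenCoord_smul (c : ℂ) (x : n → ℂ) : hA.eigenCoord (c • x) = c • hA.eigenCoord x :=
  Matrix.mulVec_smul _ _ _

theorem star_dotProduct_eq_sum_eigenCoord (x y : n → ℂ) :
    star x ⬝ᵥ y = ∑ i, star (hA.eigenCoord x i) * hA.eigenCoord y i := by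
  have h : star (hA.eigenCoord x) ⬝ᵥ hA.eigenCoord y = star x ⬝ᵥ y := by
    rw [eigenCoord, eigenCoord, Matrix.star_mulVec, ← Matrix.dotProduct_mulVec,
      Matrix.mulVec_mulVec, ← Matrix.star_eq_conjTranspose, star_star]
    simp
  exact h.symm

theorem eigenCoord_mulVec (x : n → ℂ) (i : n) :
    hA.eigenCoord (A *ᵥ x) i = hA.eigenvalues i * hA.eigenCoord x i := by
  have h : star (hA.eigenvectorUnitary : Matrix n n ℂ) * A =
      Matrix.diagonal (fun i => (hA.eigenvalues i : ℂ)) *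
        star (hA.eigenvectorUnitary : Matrix n n ℂ) := by
    have h := congrArg (star (hA.eigenvectorUnitary : Matrix n n ℂ) * ·) hA.spectral_theorem
    rw [Unitary.conjStarAlgAut_apply, ← mul_assoc, ← mul_assoc] at h
    simpa [Function.comp_def] using h
  rw [eigenCoord, Matrix.mulVec_mulVec, h, ← Matrix.mulVec_mulVec, Matrix.mulVec_diagonal]
  rfl

theorem eigenCoord_pow_mulVec (k : ℕ) (x : n → ℂ) (i : n) :
    hA.eigenCoord (A ^ k *ᵥ x) i = (hA.eigenvalues i : ℂ) ^ k * hA.eigenCoord x i := by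
  induction k with
  | zero => simp
  | succ k ih => rw [pow_succ', ← Matrix.mulVec_mulVec, eigenCoord_mulVec, ih, pow_succ', mul_assoc]

theorem re_star_dotProduct_pow_mulVec (k : ℕ) (x : n → ℂ) :
    (star x ⬝ᵥ (A ^ k *ᵥ x)).re =
      ∑ i, Complex.normSq (hA.eigenCoord x i) * hA.eigenvalues i ^ k := by
  rw [hA.star_dotProduct_eq_sum_eigenCoord, Complex.re_sum]
  refine Finset.sum_congr rfl fun i _ => ?_
  rw [eigenCoord_pow_mulVec, mul_left_comm, ← Complex.ofReal_pow, Complex.re_ofReal_mul,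
    Complex.star_def, ← Complex.normSq_eq_conj_mul_self, Complex.ofReal_re, mul_comm]

theorem sum_normSq_eigenCoord (x : n → ℂ) :
    ∑ i, Complex.normSq (hA.eigenCoord x i) = ∑ i, Complex.normSq (x i) := by
  have h := hA.re_star_dotProduct_pow_mulVec 0 x
  simp only [pow_zero, Matrix.one_mulVec, mul_one] at h
  rw [← h, dotProduct, Complex.re_sum]
  refine Finset.sum_congr rfl fun i _ => ?_
  simp [Complex.normSq_apply]

theorem sum_normSq_mulVec_le {r : ℝ} (hr : ∀ i, |hA.eigenvalues i| ≤ r) (x : n → ℂ) :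
    ∑ i, Complex.normSq ((A *ᵥ x) i) ≤ r ^ 2 * ∑ i, Complex.normSq (x i) := by
  rw [← hA.sum_normSq_eigenCoord, ← hA.sum_normSq_eigenCoord x, Finset.mul_sum]
  refine Finset.sum_le_sum fun i _ => ?_
  rw [eigenCoord_mulVec, Complex.normSq_mul, Complex.normSq_ofReal, ← abs_mul_abs_self, ← sq]
  exact mul_le_mul_of_nonneg_right (pow_le_pow_left₀ (abs_nonneg _) (hr i) 2)
    (Complex.normSq_nonneg _)

theorem eigenCoord_eq_star_dotProduct (x : n → ℂ) (i : n) :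
    hA.eigenCoord x i = star (hA.eigenvectorBasis i).ofLp ⬝ᵥ x := by
  simp [eigenCoord, Matrix.mulVec, dotProduct, Matrix.star_apply]

theorem eigenvectorBasis_ne_zero (i : n) : (hA.eigenvectorBasis i).ofLp ≠ 0 := by
  intro h
  have := hA.eigenvectorBasis.orthonormal.ne_zero i
  exact this (by ext j; simp [h])

theorem eigenvalues_eq_of_mulVec_eq {x : n → ℂ} {l : ℝ} (h : A *ᵥ x = (l : ℂ) • x) {i : n}
    (hi : hA.eigenCoord x i ≠ 0) : hA.eigenvalues i = l := by
  have := hA.eigenCoord_mulVec x i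
  rw [h, eigenCoord_smul, Pi.smul_apply, smul_eq_mul] at this
  exact_mod_cast (mul_right_cancel₀ hi this).symm

end Matrix.IsHermitian

/-- Geometric series; in eigenvector coordinates this expands the quadratic form of the resolvent at
`l`, of either sign. -/
theorem hasSum_sum_mul_pow_div_pow {ι : Type*} [Fintype ι] (c μ : ι → ℝ) {l : ℝ}
    (h : ∀ i, |μ i| < |l|) :
    HasSum (fun k : ℕ => (∑ i, c i * μ i ^ k) / l ^ (k + 1)) (∑ i, c i / (l - μ i)) := by
  simp only [Finset.sum_div]
  refine hasSum_sum fun i _ => ?_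
  have hl : l ≠ 0 := abs_pos.1 ((abs_nonneg _).trans_lt (h i))
  have hlm : l - μ i ≠ 0 := fun h0 => by
    have := h i
    rw [sub_eq_zero.1 h0] at this
    exact lt_irrefl _ this
  have hq : |μ i / l| < 1 := by
    rw [abs_div, div_lt_one (abs_pos.2 hl)]
    exact h i
  have := (hasSum_geometric_of_abs_lt_one hq).mul_left (c i / l)
  have hfun : (fun k : ℕ => c i * μ i ^ k / l ^ (k + 1)) = fun k => c i / l * (μ i / l) ^ k := by
    ext k
    rw [div_pow, pow_succ, div_mul_div_comm, mul_comm l]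
  have hval : c i / (l - μ i) = c i / l * (1 - μ i / l)⁻¹ := by
    rw [one_sub_div hl, inv_div, div_mul_div_cancel₀ hl]
  rwa [hfun, hval]

open scoped Matrix

/-! ### The spectral radius as a norm bound -/

namespace MixedGraph

variable {V : Type*} [Fintype V] [DecidableEq V]

theorem abs_eigenvalues_le_spectralRadius (D : MixedGraph V) (i : V) :
    |D.hermAdj_isHermitian.eigenvalues i| ≤ D.spectralRadius :=
  le_ciSup (f := fun i => |D.hermAdj_isHermitian.eigenvalues i|) (Set.finite_range _).bddAbove i

theorem sum_normSq_hermAdj_mulVec_le (D : MixedGraph V) (x : V → ℂ) :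
    ∑ a, Complex.normSq ((D.hermAdj *ᵥ x) a) ≤
      D.spectralRadius ^ 2 * ∑ a, Complex.normSq (x a) :=
  D.hermAdj_isHermitian.sum_normSq_mulVec_le D.abs_eigenvalues_le_spectralRadius x

theorem spectralRadius_nonneg (D : MixedGraph V) : 0 ≤ D.spectralRadius :=
  Real.iSup_nonneg fun _ => abs_nonneg _

theorem spectralRadius_lt [Nonempty V] (D : MixedGraph V) {r : ℝ}
    (h : ∀ (f : V → ℂ) (l : ℝ), D.hermAdj *ᵥ f = (l : ℂ) • f → r ≤ |l| → f = 0) :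
    D.spectralRadius < r := by
  obtain ⟨i, hi⟩ := exists_eq_ciSup_of_finite (f := fun i => |D.hermAdj_isHermitian.eigenvalues i|)
  by_contra! hr
  refine D.hermAdj_isHermitian.eigenvectorBasis_ne_zero i
    (h _ _ (D.hermAdj_isHermitian.mulVec_eigenvectorBasis i) ?_)
  exact hr.trans_eq hi.symm

theorem spectralRadius_pos (D : MixedGraph V) {u v : V} (h : D.underlying.Adj u v) :
    0 < D.spectralRadius := by
  refine D.spectralRadius_nonneg.lt_of_ne fun h0 => ?_
  have := D.sum_normSq_hermAdj_mulVec_le (Pi.single v 1)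
  rw [← h0, zero_pow two_ne_zero, zero_mul] at this
  have h1 := (Finset.single_le_sum (fun a _ => Complex.normSq_nonneg _) (Finset.mem_univ u)).trans
    this
  have h2 := Complex.normSq_eq_zero.1 (le_antisymm h1 (Complex.normSq_nonneg _))
  rw [Matrix.mulVec_single_one, Matrix.col_apply] at h2
  have h3 := D.hermAdj_mul_hermAdj_symm h
  simp [h2] at h3

end MixedGraph

/-! ### Splitting off a vertex -/

namespace MixedGraph

variable {V : Type*} {D : MixedGraph V}

theorem hermAdj_deleteEdge_apply_of_ne {e : Sym2 V} {a b : V} (h : s(a, b) ≠ e) :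
    (D.deleteEdge e).hermAdj a b = D.hermAdj a b := by
  have h₁ : (D.deleteEdge e).arc a b ↔ D.arc a b := and_iff_left h
  have h₂ : (D.deleteEdge e).arc b a ↔ D.arc b a := and_iff_left (by rwa [Sym2.eq_swap])
  have h₃ : (D.deleteEdge e).underlying.Adj a b ↔ D.underlying.Adj a b :=
    SimpleGraph.deleteEdges_adj.trans (and_iff_left h)
  have h₀ : (D.deleteEdge e).IsUndirected a b ↔ D.IsUndirected a b := by
    rw [IsUndirected, IsUndirected, h₁, h₂, h₃]
  rw [hermAdj, hermAdj, Matrix.of_apply, Matrix.of_apply, h₀, h₁, h₂]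

theorem hermAdj_deleteEdge_apply_self {e : Sym2 V} {a b : V} (h : s(a, b) = e) :
    (D.deleteEdge e).hermAdj a b = 0 :=
  hermAdj_apply_eq_zero _ fun h' => ((SimpleGraph.deleteEdges_adj).1 h').2 h

theorem hermAdj_deleteEdge_col [DecidableEq V] (u v : V) :
    (D.deleteEdge s(u, v)).hermAdj.col u =
      fun a => ((if a = v then 0 else 1 : ℝ) : ℂ) * D.hermAdj a u := by
  ext a
  rw [Matrix.col_apply]
  by_cases ha : a = v
  · rw [hermAdj_deleteEdge_apply_self (by rw [ha, Sym2.eq_swap]), if_pos ha]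
    simp
  · rw [hermAdj_deleteEdge_apply_of_ne, if_neg ha]
    · simp
    · rw [Sym2.eq_swap]
      intro h
      exact ha (Sym2.congr_right.1 h)

theorem star_hermAdj_col_dotProduct [Fintype V] (u : V) (f : V → ℂ) :
    star (D.hermAdj.col u) ⬝ᵥ f = (D.hermAdj *ᵥ f) u := by
  refine Finset.sum_congr rfl fun a _ => ?_
  rw [Pi.star_apply, Matrix.col_apply, star_hermAdj_apply]

theorem sum_normSq_smul [Fintype V] (c : ℂ) (f : V → ℂ) :
    ∑ a, Complex.normSq ((c • f) a) = Complex.normSq c * ∑ a, Complex.normSq (f a) := by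
  simp [Finset.mul_sum]

theorem sum_normSq_pos [Fintype V] {f : V → ℂ} (hf : f ≠ 0) : 0 < ∑ a, Complex.normSq (f a) := by
  obtain ⟨a, ha⟩ := Function.ne_iff.1 hf
  exact Finset.sum_pos' (fun a _ => Complex.normSq_nonneg _)
    ⟨a, Finset.mem_univ a, Complex.normSq_pos.2 ha⟩

theorem hermAdjOn_compl_mulVec_self [Fintype V] (u : V) (f : V → ℂ) : (D.hermAdjOn {u}ᶜ *ᵥ f) u = 0 :=
  Finset.sum_eq_zero fun b _ => by
    change D.hermAdjOn {u}ᶜ u b * f b = 0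
    rw [hermAdjOn_apply_of_notMem_left (by simp), zero_mul]

theorem eigenvector_apply_eq_zero [Fintype V] {u : V} {f : V → ℂ} {l : ℝ} (hl : l ≠ 0)
    (h : D.hermAdjOn {u}ᶜ *ᵥ f = (l : ℂ) • f) : f u = 0 := by
  have := congrFun h u
  rw [hermAdjOn_compl_mulVec_self, Pi.smul_apply, smul_eq_mul, eq_comm, mul_eq_zero] at this
  exact this.resolve_left (by exact_mod_cast hl)

variable [Fintype V] [DecidableEq V]

theorem hermAdjOn_compl_mulVec_of_ne {u : V} {f : V → ℂ} (hf : f u = 0) {a : V} (ha : a ≠ u) :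
    (D.hermAdjOn {u}ᶜ *ᵥ f) a = (D.hermAdj *ᵥ f) a := by
  refine Finset.sum_congr rfl fun b _ => ?_
  change D.hermAdjOn {u}ᶜ a b * f b = D.hermAdj a b * f b
  by_cases hb : b = u
  · rw [hb, hf, mul_zero, mul_zero]
  · rw [hermAdjOn_apply_of_mem (S := {u}ᶜ) ha hb]

theorem hermAdj_mulVec_eq_add {u : V} {f : V → ℂ} (hf : f u = 0) :
    D.hermAdj *ᵥ f = D.hermAdjOn {u}ᶜ *ᵥ f + Pi.single u ((D.hermAdj *ᵥ f) u) := by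
  ext a
  by_cases ha : a = u
  · subst ha
    simp [hermAdjOn_compl_mulVec_self]
  · simp [hermAdjOn_compl_mulVec_of_ne hf ha, ha]

theorem sum_normSq_add_single {u : V} {f : V → ℂ} (hf : f u = 0) (c : ℂ) :
    ∑ a, Complex.normSq ((f + (Pi.single u c : V → ℂ)) a) =
      ∑ a, Complex.normSq (f a) + Complex.normSq c := by
  rw [← Finset.add_sum_erase _ _ (Finset.mem_univ u),
    ← Finset.add_sum_erase _ (fun a => Complex.normSq (f a)) (Finset.mem_univ u)]
  have : ∀ a ∈ Finset.univ.erase u, Complex.normSq ((f + (Pi.single u c : V → ℂ)) a) =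
      Complex.normSq (f a) := fun a ha => by
    simp [Finset.ne_of_mem_erase ha]
  rw [Finset.sum_congr rfl this]
  simp [hf, add_comm]

/-! ### Extremal eigenvectors and vertex deletion -/

/-- As f_u = 0, Hf = l f + (Hf)_u e_u with orthogonal summands, so l²‖f‖² + |(Hf)_u|² ≤ ρ²‖f‖² ≤
l²‖f‖². -/
theorem extremal_eigenvector_of_compl {u : V} {f : V → ℂ} {l : ℝ} (hρ : 0 < D.spectralRadius)
    (hl : D.spectralRadius ≤ |l|) (h : D.hermAdjOn {u}ᶜ *ᵥ f = (l : ℂ) • f) :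
    (D.hermAdj *ᵥ f) u = 0 ∧ (f ≠ 0 → |l| = D.spectralRadius) := by
  have hfu := eigenvector_apply_eq_zero (abs_pos.1 (hρ.trans_le hl)) h
  have hle := D.sum_normSq_hermAdj_mulVec_le f
  rw [hermAdj_mulVec_eq_add hfu, h, sum_normSq_add_single (by simp [hfu]), sum_normSq_smul,
    Complex.normSq_ofReal, ← abs_mul_abs_self, ← sq] at hle
  have hsq : D.spectralRadius ^ 2 ≤ |l| ^ 2 := pow_le_pow_left₀ hρ.le hl 2
  have hn : 0 ≤ ∑ a, Complex.normSq (f a) := Finset.sum_nonneg fun a _ => Complex.normSq_nonneg _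
  have hmul := mul_le_mul_of_nonneg_right hsq hn
  have hz := Complex.normSq_nonneg ((D.hermAdj *ᵥ f) u)
  refine ⟨Complex.normSq_eq_zero.1 (by linarith), fun hf => le_antisymm ?_ hl⟩
  refine le_of_sq_le_sq ?_ hρ.le
  exact le_of_mul_le_mul_right (by linarith) (sum_normSq_pos hf)

/-- The real weights `s` cover both the full column and the column with one entry erased. -/
theorem re_star_col_dotProduct_pow (u : V) (k : ℕ) (s : V → ℝ) :
    (star (fun a => (s a : ℂ) * D.hermAdj a u) ⬝ᵥ
        (D.hermAdjOn {u}ᶜ ^ k *ᵥ fun a => (s a : ℂ) * D.hermAdj a u)).re =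
      ∑ a, ∑ b, s a * s b *
        (D.hermAdj u a * (D.hermAdjOn {u}ᶜ ^ k) a b * D.hermAdj b u).re := by
  simp only [dotProduct, Matrix.mulVec, Complex.re_sum, Finset.mul_sum]
  refine Finset.sum_congr rfl fun a _ => Finset.sum_congr rfl fun b _ => ?_
  rw [← Complex.re_ofReal_mul, Pi.star_apply, star_mul', star_hermAdj_apply, Complex.star_def,
    Complex.conj_ofReal]
  congr 1
  push_cast
  ring

/-- Deleting the neighbour `v` of `u` from the closed walks leaving `u` at `v` or returning from
`v` costs at least the closed walks at `v`. -/
theorem RealCyclesPositive.re_dotProduct_pow_add_le (hD : D.RealCyclesPositive) {u v : V}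
    (huv : D.underlying.Adj u v) (k : ℕ) :
    0 ≤ (star (fun a => ((if a = v then 0 else 1 : ℝ) : ℂ) * D.hermAdj a u) ⬝ᵥ
        (D.hermAdjOn {u}ᶜ ^ k *ᵥ
          fun a => ((if a = v then 0 else 1 : ℝ) : ℂ) * D.hermAdj a u)).re ∧
      (star (fun a => ((if a = v then 0 else 1 : ℝ) : ℂ) * D.hermAdj a u) ⬝ᵥ
        (D.hermAdjOn {u}ᶜ ^ k *ᵥ
          fun a => ((if a = v then 0 else 1 : ℝ) : ℂ) * D.hermAdj a u)).re +
        ((D.hermAdjOn {u}ᶜ ^ k) v v).re ≤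
      (star (D.hermAdj.col u) ⬝ᵥ (D.hermAdjOn {u}ᶜ ^ k *ᵥ D.hermAdj.col u)).re := by
  have hcol : D.hermAdj.col u = fun a => ((1 : ℝ) : ℂ) * D.hermAdj a u := by
    ext a
    simp
  have ht := hD.re_closed_pow_nonneg k u
  have hv : (D.hermAdj u v * (D.hermAdjOn {u}ᶜ ^ k) v v * D.hermAdj v u).re =
      ((D.hermAdjOn {u}ᶜ ^ k) v v).re := by
    rw [mul_right_comm, D.hermAdj_mul_hermAdj_symm huv, one_mul]
  rw [hcol, re_star_col_dotProduct_pow u k (fun a => if a = v then 0 else 1),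
    re_star_col_dotProduct_pow u k (fun _ => 1), ← hv]
  constructor
  · refine Finset.sum_nonneg fun a _ => Finset.sum_nonneg fun b _ => mul_nonneg ?_ (ht a b)
    split_ifs <;> norm_num
  · have hsingle : (D.hermAdj u v * (D.hermAdjOn {u}ᶜ ^ k) v v * D.hermAdj v u).re =
        ∑ a, ∑ b, if a = v then if b = v then
          (D.hermAdj u a * (D.hermAdjOn {u}ᶜ ^ k) a b * D.hermAdj b u).re else 0 else 0 := by
      simp only [Finset.sum_ite_irrel, Finset.sum_const_zero, Finset.sum_ite_eq', Finset.mem_univ,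
        if_true]
    rw [hsingle, ← Finset.sum_add_distrib]
    refine Finset.sum_le_sum fun a _ => ?_
    rw [← Finset.sum_add_distrib]
    refine Finset.sum_le_sum fun b _ => ?_
    have := ht a b
    split_ifs <;> linarith

theorem re_pow_diag_eq (S : Set V) (k : ℕ) (v : V) :
    ((D.hermAdjOn S ^ k) v v).re =
      ∑ i, Complex.normSq ((D.hermAdjOn_isHermitian S).eigenCoord (Pi.single v 1) i) *
        (D.hermAdjOn_isHermitian S).eigenvalues i ^ k := by
  rw [← (D.hermAdjOn_isHermitian S).re_star_dotProduct_pow_mulVec]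
  simp

/-- The coordinate is the conjugate of (Hf)_u for the i-th eigenvector f. -/
theorem eigenCoord_col_eq_zero {u : V} (hρ : 0 < D.spectralRadius) (i : V)
    (hi : D.spectralRadius ≤ |(D.hermAdjOn_isHermitian {u}ᶜ).eigenvalues i|) :
    (D.hermAdjOn_isHermitian {u}ᶜ).eigenCoord (D.hermAdj.col u) i = 0 := by
  have h := (extremal_eigenvector_of_compl hρ hi
    ((D.hermAdjOn_isHermitian {u}ᶜ).mulVec_eigenvectorBasis i)).1
  rw [Matrix.IsHermitian.eigenCoord_eq_star_dotProduct, Matrix.star_dotProduct,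
    star_hermAdj_col_dotProduct, h, star_zero]

/-- If f_v ≠ 0, then (A^2m)_vv ≥ p l^2m with p > 0. It is at most z*A^2m z, which is o(l^2m) since z
has no extremal coordinates. Even exponents make all terms nonnegative. -/
theorem RealCyclesPositive.extremal_eigenvector_apply_eq_zero (hD : D.RealCyclesPositive)
    {u v : V} (huv : D.underlying.Adj u v) {f : V → ℂ} {l : ℝ} (hl : |l| = D.spectralRadius)
    (hf : D.hermAdj *ᵥ f = (l : ℂ) • f) (hfu : f u = 0) : f v = 0 := by
  have hρ := D.spectralRadius_pos huv
  set hA := D.hermAdjOn_isHermitian {u}ᶜ with hA_def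
  have hf₀ : D.hermAdjOn {u}ᶜ *ᵥ f = (l : ℂ) • f := by
    ext a
    by_cases ha : a = u
    · rw [ha, hermAdjOn_compl_mulVec_self, Pi.smul_apply, hfu, smul_zero]
    · rw [hermAdjOn_compl_mulVec_of_ne hfu ha, hf]
  by_contra hfv
  -- Otherwise the inner product of e_v and f, which is f_v, would vanish.
  have hex : ∃ i, hA.eigenCoord (Pi.single v 1) i ≠ 0 ∧ hA.eigenCoord f i ≠ 0 := by
    by_contra! hno
    refine hfv ?_
    have := hA.star_dotProduct_eq_sum_eigenCoord (Pi.single v 1) f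
    rw [Finset.sum_eq_zero fun i _ => ?_] at this
    · simpa [← Pi.single_star] using this
    · by_cases hi : hA.eigenCoord (Pi.single v 1) i = 0
      · simp [hi]
      · simp [hno i hi]
  obtain ⟨i, hi, hfi⟩ := hex
  have hli := hA.eigenvalues_eq_of_mulVec_eq hf₀ hfi
  set p := Complex.normSq (hA.eigenCoord (Pi.single v 1) i) with hp
  have hp0 : 0 < p := Complex.normSq_pos.2 hi
  have hlim : Filter.Tendsto (fun m : ℕ => ∑ j, Complex.normSq
      (hA.eigenCoord (D.hermAdj.col u) j) * ((hA.eigenvalues j / l) ^ 2) ^ m)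
      Filter.atTop (nhds (∑ _j : V, 0)) := by
    refine tendsto_finsetSum _ fun j _ => ?_
    by_cases hj : D.spectralRadius ≤ |hA.eigenvalues j|
    · simp [eigenCoord_col_eq_zero hρ j hj]
    · rw [← mul_zero (Complex.normSq (hA.eigenCoord (D.hermAdj.col u) j))]
      refine (tendsto_pow_atTop_nhds_zero_of_lt_one (sq_nonneg _) ?_).const_mul _
      rw [sq_lt_one_iff_abs_lt_one, abs_div, hl, div_lt_one hρ]
      exact not_le.1 hj
  rw [Finset.sum_const_zero] at hlim
  refine hp0.not_ge (ge_of_tendsto' hlim fun m => ?_)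
  have hl0 : 0 < (l ^ 2) ^ m := by
    rw [← sq_abs, hl]
    positivity
  have h1 := hD.re_dotProduct_pow_add_le huv (2 * m)
  have h2 := hA.re_star_dotProduct_pow_mulVec (2 * m) (D.hermAdj.col u)
  have h3 : p * l ^ (2 * m) ≤ ((D.hermAdjOn {u}ᶜ ^ (2 * m)) v v).re := by
    rw [re_pow_diag_eq, hp, ← hli]
    refine Finset.single_le_sum (f := fun i => Complex.normSq (hA.eigenCoord (Pi.single v 1) i) *
      hA.eigenvalues i ^ (2 * m)) (fun j _ => ?_) (Finset.mem_univ i)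
    rw [pow_mul]
    exact mul_nonneg (Complex.normSq_nonneg _) (by positivity)
  have h4 : p * l ^ (2 * m) ≤ ∑ j, Complex.normSq (hA.eigenCoord (D.hermAdj.col u) j) *
      hA.eigenvalues j ^ (2 * m) := by
    rw [← h2]
    linarith [h1.1, h1.2]
  have h5 : ∑ j, Complex.normSq (hA.eigenCoord (D.hermAdj.col u) j) *
      ((hA.eigenvalues j / l) ^ 2) ^ m = (∑ j, Complex.normSq
        (hA.eigenCoord (D.hermAdj.col u) j) * hA.eigenvalues j ^ (2 * m)) / (l ^ 2) ^ m := by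
    rw [Finset.sum_div]
    refine Finset.sum_congr rfl fun j _ => ?_
    rw [div_pow, div_pow, pow_mul, mul_div_assoc]
  rw [h5, le_div_iff₀ hl0, ← pow_mul]
  exact h4

theorem RealCyclesPositive.eq_zero_of_compl_eigenvector (hD : D.RealCyclesPositive)
    (hconn : D.underlying.Connected) {u : V} {f : V → ℂ} {l : ℝ} (hρ : 0 < D.spectralRadius)
    (hl : D.spectralRadius ≤ |l|) (hf : D.hermAdjOn {u}ᶜ *ᵥ f = (l : ℂ) • f) : f = 0 := by
  by_contra hf0
  obtain ⟨h1, h2⟩ := extremal_eigenvector_of_compl hρ hl hf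
  have hl' := h2 hf0
  have hfu := eigenvector_apply_eq_zero (abs_pos.1 (hρ.trans_le hl)) hf
  have hH : D.hermAdj *ᵥ f = (l : ℂ) • f := by
    rw [hermAdj_mulVec_eq_add hfu, h1, hf]
    simp
  refine hf0 (funext fun w => ?_)
  obtain ⟨p⟩ := hconn.preconnected u w
  -- These mention `u`, which moves along the walk, and would burden the induction hypothesis.
  clear h1 hf
  induction p with
  | nil => exact hfu
  | cons h p ih => exact ih (hD.extremal_eigenvector_apply_eq_zero h hl' hH hfu)

theorem RealCyclesPositive.spectralRadius_deleteVertex_lt [Nontrivial V]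
    (hD : D.RealCyclesPositive) (hconn : D.underlying.Connected) (u : V) :
    (D.deleteVertex u).spectralRadius < D.spectralRadius := by
  obtain ⟨v, hv⟩ := hconn.preconnected.exists_adj_of_nontrivial u
  have hρ := D.spectralRadius_pos hv
  have : Nonempty {w : V // w ≠ u} := ⟨⟨v, hv.ne'⟩⟩
  refine (D.deleteVertex u).spectralRadius_lt fun f l hf hl => ?_
  set g : V → ℂ := fun a => if h : a ≠ u then f ⟨a, h⟩ else 0 with hg
  have hgu : g u = 0 := by simp [hg]
  have hga : ∀ a : {w : V // w ≠ u}, g a = f a := fun a => by simp [hg, a.2]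
  have hg0 : g = 0 := by
    refine hD.eq_zero_of_compl_eigenvector hconn (u := u) hρ hl ?_
    ext a
    by_cases ha : a = u
    · rw [ha, hermAdjOn_compl_mulVec_self, Pi.smul_apply, hgu, smul_zero]
    · have := congrFun hf ⟨a, ha⟩
      rw [Pi.smul_apply, hga ⟨a, ha⟩, ← Pi.smul_apply, ← this, hermAdjOn_compl_mulVec_of_ne hgu ha]
      have hsum := Fintype.sum_subtype_add_sum_subtype (fun b => b ≠ u)
        fun b => D.hermAdj a b * g b
      have hcompl : ∀ b : {b // ¬ b ≠ u}, D.hermAdj a b * g b = 0 := fun b => by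
        rw [not_not.1 b.2, hgu, mul_zero]
      rw [Finset.sum_eq_zero fun b _ => hcompl b, add_zero] at hsum
      refine hsum.symm.trans (Finset.sum_congr rfl fun b _ => ?_)
      rw [hga]
      rfl
  ext a
  rw [← hga, hg0]
  rfl

/-- Test vector g + e_u with g = (x - A)⁻¹z. With φ the left side, H(g + e_u) = x g + φ e_u, so
x²‖g‖² + φ² ≤ ρ²(‖g‖² + 1) ≤ x²(‖g‖² + 1). -/
theorem RealCyclesPositive.sum_div_le (hD : D.RealCyclesPositive)
    (hconn : D.underlying.Connected) {u : V} {x : ℝ} (hρ : 0 < D.spectralRadius)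
    (hx : D.spectralRadius ≤ x) :
    ∑ i, Complex.normSq ((D.hermAdjOn_isHermitian {u}ᶜ).eigenCoord (D.hermAdj.col u) i) /
      (x - (D.hermAdjOn_isHermitian {u}ᶜ).eigenvalues i) ≤ x := by
  set hA := D.hermAdjOn_isHermitian {u}ᶜ with hA_def
  have hx0 : 0 < x := hρ.trans_le hx
  have hμ : ∀ i, (x : ℂ) - hA.eigenvalues i ≠ 0 := by
    intro i h0
    have h1 : x = hA.eigenvalues i := by exact_mod_cast sub_eq_zero.1 h0
    refine hA.eigenvectorBasis_ne_zero i (hD.eq_zero_of_compl_eigenvector hconn (u := u) hρ ?_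
      (hA.mulVec_eigenvectorBasis i))
    change D.spectralRadius ≤ |hA.eigenvalues i|
    rwa [← h1, abs_of_pos hx0]
  set z := D.hermAdj.col u with hz
  set φ := ∑ i, Complex.normSq (hA.eigenCoord z i) / (x - hA.eigenvalues i) with hφ
  set g := (hA.eigenvectorUnitary : Matrix V V ℂ) *ᵥ
    fun i => hA.eigenCoord z i / ((x : ℂ) - hA.eigenvalues i) with hg
  have hgi : ∀ i, hA.eigenCoord g i = hA.eigenCoord z i / ((x : ℂ) - hA.eigenvalues i) :=
    fun i => congrFun (hA.eigenCoord_eigenvectorUnitary_mulVec _) i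
  have hAg : D.hermAdjOn {u}ᶜ *ᵥ g = (x : ℂ) • g - z := by
    refine hA.eigenCoord_injective (funext fun i => ?_)
    rw [hA.eigenCoord_mulVec, hA.eigenCoord_sub, hA.eigenCoord_smul, Pi.sub_apply, Pi.smul_apply,
      hgi, smul_eq_mul]
    have := hμ i
    field_simp
    ring
  have hgu : g u = 0 := by
    have := congrFun hAg u
    rw [hermAdjOn_compl_mulVec_self, Pi.sub_apply, hz, Matrix.col_apply,
      D.hermAdj_apply_eq_zero (D.underlying.loopless.irrefl u), sub_zero, Pi.smul_apply,
      smul_eq_mul, eq_comm, mul_eq_zero] at this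
    exact this.resolve_left (by exact_mod_cast hx0.ne')
  have hHg : (D.hermAdj *ᵥ g) u = φ := by
    rw [← star_hermAdj_col_dotProduct, hA.star_dotProduct_eq_sum_eigenCoord, hφ]
    push_cast
    refine Finset.sum_congr rfl fun i _ => ?_
    rw [hgi, Complex.normSq_eq_conj_mul_self, Complex.star_def, mul_div_assoc]
  have hH : D.hermAdj *ᵥ (g + Pi.single u 1) = (x : ℂ) • g + Pi.single u (φ : ℂ) := by
    rw [Matrix.mulVec_add, hermAdj_mulVec_eq_add hgu, hHg, hAg, Matrix.mulVec_single_one, ← hz]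
    abel
  have hle := D.sum_normSq_hermAdj_mulVec_le (g + Pi.single u 1)
  rw [hH, sum_normSq_add_single hgu, sum_normSq_add_single (by simp [hgu]), sum_normSq_smul,
    Complex.normSq_ofReal, Complex.normSq_ofReal, Complex.normSq_one] at hle
  have hn : 0 ≤ ∑ a, Complex.normSq (g a) := Finset.sum_nonneg fun a _ => Complex.normSq_nonneg _
  have hsq : D.spectralRadius ^ 2 ≤ x ^ 2 := pow_le_pow_left₀ hρ.le hx 2
  have := mul_le_mul_of_nonneg_right hsq (add_nonneg hn zero_le_one)
  refine le_of_sq_le_sq ?_ hx0.le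
  linarith

/-! ### Edge deletion -/

theorem hermAdj_deleteEdge_mulVec_of_ne {u v : V} {f : V → ℂ} (hf : f u = 0) {a : V}
    (ha : a ≠ u) : ((D.deleteEdge s(u, v)).hermAdj *ᵥ f) a = (D.hermAdj *ᵥ f) a := by
  refine Finset.sum_congr rfl fun b _ => ?_
  change (D.deleteEdge s(u, v)).hermAdj a b * f b = D.hermAdj a b * f b
  by_cases h : s(a, b) = s(u, v)
  · have hb : b = u := by
      rcases Sym2.eq_iff.1 h with h | h
      · exact absurd h.1 ha
      · exact h.2
    rw [hb, hf, mul_zero, mul_zero]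
  · rw [hermAdj_deleteEdge_apply_of_ne h]

theorem RealCyclesPositive.spectralRadius_deleteEdge_lt
    (hD : D.RealCyclesPositive) (hconn : D.underlying.Connected) {u v : V}
    (huv : D.underlying.Adj u v) :
    (D.deleteEdge s(u, v)).spectralRadius < D.spectralRadius := by
  have hρ := D.spectralRadius_pos huv
  have : Nonempty V := ⟨u⟩
  refine (D.deleteEdge s(u, v)).spectralRadius_lt fun f l hf hl => ?_
  have hl0 : l ≠ 0 := abs_pos.1 (hρ.trans_le hl)
  set hA := D.hermAdjOn_isHermitian {u}ᶜ with hA_def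
  have hμ : ∀ i, |hA.eigenvalues i| < |l| := by
    refine fun i => lt_of_lt_of_le (lt_of_not_ge fun h => ?_) hl
    exact hA.eigenvectorBasis_ne_zero i (hD.eq_zero_of_compl_eigenvector hconn hρ h
      (hA.mulVec_eigenvectorBasis i))
  set t := f u with ht
  set g := f - Pi.single u t with hg
  have hfg : f = g + t • Pi.single u 1 := by
    rw [hg, ← Pi.single_smul]
    simp
  have hgu : g u = 0 := by simp [hg, ht]
  set H' := (D.deleteEdge s(u, v)).hermAdj with hH'
  set z := H'.col u with hz
  have hloop : H' u u = 0 :=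
    hermAdj_apply_eq_zero _ ((D.deleteEdge s(u, v)).underlying.loopless.irrefl u)
  have hH'f : H' *ᵥ f = H' *ᵥ g + t • z := by
    conv_lhs => rw [hfg]
    rw [Matrix.mulVec_add, Matrix.mulVec_smul, Matrix.mulVec_single_one]
  have hAg : (l : ℂ) • g = D.hermAdjOn {u}ᶜ *ᵥ g + t • z := by
    ext a
    by_cases ha : a = u
    · subst ha
      simp [hermAdjOn_compl_mulVec_self, hgu, hz, hloop]
    · have h1 := congrFun hf a
      rw [hH'f, Pi.add_apply, hermAdj_deleteEdge_mulVec_of_ne hgu ha,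
        ← hermAdjOn_compl_mulVec_of_ne hgu ha] at h1
      have h2 : f a = g a := by simp [hg, ha]
      rw [Pi.smul_apply, ← h2, ← Pi.smul_apply, ← h1, Pi.add_apply]
  -- The rows other than `u` give (l - A)g = t z'.
  have hgi : ∀ i, hA.eigenCoord g i = t * hA.eigenCoord z i / ((l : ℂ) - hA.eigenvalues i) := by
    intro i
    have h1 := congrArg (fun y => hA.eigenCoord y i) hAg
    simp only [hA.eigenCoord_add, hA.eigenCoord_smul, Pi.add_apply, Pi.smul_apply, smul_eq_mul,
      hA.eigenCoord_mulVec] at h1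
    have h2 : (l : ℂ) - hA.eigenvalues i ≠ 0 := by
      intro h0
      have h3 : l = hA.eigenvalues i := by exact_mod_cast sub_eq_zero.1 h0
      exact (hμ i).ne (by rw [h3])
    rw [eq_div_iff h2]
    linear_combination h1
  -- Row `u` gives the secular equation, multiplied by `t`.
  have hlt : (l : ℂ) * t = t * ((∑ i, Complex.normSq (hA.eigenCoord z i) /
      (l - hA.eigenvalues i) : ℝ) : ℂ) := by
    have h1 := congrFun hf u
    rw [hH'f, Pi.add_apply, ← star_hermAdj_col_dotProduct, hA.star_dotProduct_eq_sum_eigenCoord,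
      Pi.smul_apply, Pi.smul_apply, hz, Matrix.col_apply, hloop, smul_zero, add_zero, smul_eq_mul,
      ← ht] at h1
    rw [← h1, Complex.ofReal_sum, Finset.mul_sum]
    refine Finset.sum_congr rfl fun i _ => ?_
    rw [hgi, Complex.ofReal_div, Complex.normSq_eq_conj_mul_self, Complex.star_def]
    push_cast
    ring
  by_cases ht0 : t = 0
  · rw [ht0, zero_smul, add_zero] at hfg hAg
    rw [hfg]
    exact hD.eq_zero_of_compl_eigenvector hconn hρ hl hAg.symm
  exfalso
  have hl_eq : l = ∑ i, Complex.normSq (hA.eigenCoord z i) / (l - hA.eigenvalues i) := by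
    rw [mul_comm] at hlt
    exact_mod_cast mul_left_cancel₀ ht0 hlt
  have hs' := hasSum_sum_mul_pow_div_pow (fun i => Complex.normSq (hA.eigenCoord z i))
    hA.eigenvalues hμ
  rw [← hl_eq] at hs'
  have hs := hasSum_sum_mul_pow_div_pow (l := |l|)
    (fun i => Complex.normSq (hA.eigenCoord (D.hermAdj.col u) i)) hA.eigenvalues (by simpa using hμ)
  have hbound := hD.sum_div_le hconn (u := u) hρ hl
  refine hbound.not_gt ?_
  have hk : ∀ k, 0 ≤ ∑ i, Complex.normSq (hA.eigenCoord z i) * hA.eigenvalues i ^ k ∧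
      ∑ i, Complex.normSq (hA.eigenCoord z i) * hA.eigenvalues i ^ k +
        ((D.hermAdjOn {u}ᶜ ^ k) v v).re ≤
      ∑ i, Complex.normSq (hA.eigenCoord (D.hermAdj.col u) i) * hA.eigenvalues i ^ k := by
    intro k
    rw [← hA.re_star_dotProduct_pow_mulVec, ← hA.re_star_dotProduct_pow_mulVec, hz, hH',
      hermAdj_deleteEdge_col]
    exact hD.re_dotProduct_pow_add_le huv k
  have hvv : ∀ k, 0 ≤ ((D.hermAdjOn {u}ᶜ ^ k) v v).re := fun k =>
    hD.re_pow_diag_nonneg k huv.ne'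
  have hlpos : 0 < |l| := abs_pos.2 hl0
  -- `l` may be negative, so the series is compared through absolute values.
  have habs : HasSum (fun k : ℕ => |(∑ i, Complex.normSq (hA.eigenCoord z i) *
      hA.eigenvalues i ^ k) / l ^ (k + 1)|)
      (∑' k : ℕ, |(∑ i, Complex.normSq (hA.eigenCoord z i) *
      hA.eigenvalues i ^ k) / l ^ (k + 1)|) := hs'.summable.abs.hasSum
  have hle : |l| ≤ ∑' k : ℕ, |(∑ i, Complex.normSq (hA.eigenCoord z i) *
      hA.eigenvalues i ^ k) / l ^ (k + 1)| := by
    refine abs_le.2 ⟨?_, hasSum_le (fun k => le_abs_self _) hs' habs⟩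
    exact hasSum_le (fun k => neg_abs_le _) habs.neg hs'
  -- Strictness comes from k = 0, where (A^0)_vv = 1.
  refine hle.trans_lt (hasSum_lt (i := 0) (fun k => ?_) ?_ habs hs)
  · change |_ / _| ≤ _ / _
    rw [abs_div, abs_pow, abs_of_nonneg (hk k).1]
    exact div_le_div_of_nonneg_right (by linarith [(hk k).2, hvv k]) (pow_nonneg hlpos.le _)
  · rw [abs_div, abs_pow, abs_of_nonneg (hk 0).1]
    have h1 := (hk 0).2
    have h2 : ((D.hermAdjOn {u}ᶜ ^ 0) v v).re = 1 := by simp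
    exact div_lt_div_of_pos_right (by linarith) (pow_pos hlpos _)

end MixedGraph

theorem mainTheorem4 {V : Type*} [Fintype V] [DecidableEq V] [Nontrivial V]
    (D : MixedGraph V) (hconn : D.underlying.Connected)
    (hcyc : ∀ (v : V) (C : D.underlying.Walk v v), C.IsCycle → D.IsReal C →
      D.IsPositive C ∧ Even C.length) :
    (∀ u : V, (D.deleteVertex u).spectralRadius < D.spectralRadius) ∧
      (∀ e ∈ D.underlying.edgeSet, (D.deleteEdge e).spectralRadius < D.spectralRadius) := by
  have hD : D.RealCyclesPositive := fun v C hC hR => (hcyc v C hC hR).1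
  refine ⟨hD.spectralRadius_deleteVertex_lt hconn, fun e he => ?_⟩
  induction e using Sym2.ind with
  | _ u v => exact hD.spectralRadius_deleteEdge_lt hconn he
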